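/- **Setting.** Let $\mathcal B_n=\{-1,1\}^n$ and $X\sim\mathcal N(0,I_n)$. For $\sigma\in\mathcal B_n$ let $H(\sigma)=n^{-1/2}|\langle\sigma,X\rangle|$, and for a deterministic sequence $\beta=(\beta_n)_{n\ge1}$ of positive reals let $\pi_\beta(\sigma)=Z_\beta^{-1}e^{-\beta_n H(\sigma)}$, with $Z_\beta=\sum_{\sigma\in\mathcal B_n} e^{-\beta_n H(\sigma)}$, be the Gibbs measure on $\mathcal B_n$. Let $\sigma^*$ be a minimizer of $H$ (the statements hold for every choice of the minimizer). "With high probability" (w.h.p.) means with probability tending to $1$ over $X$ as $n\to\infty$. For $\varepsilon\in(1/2,1)$ call $\rho\in(0,1)$ an *OGP parameter* for $\varepsilon$ if for every $K>0$ there is $c>0$ such that, for all large $n$, with probability at least $1-e^{-cn}$ there are no $\sigma,\sigma'\in\mathcal B_n$ with $\frac1n|\langle\sigma,\sigma'\rangle|\in[\rho,\frac{n-2}n]$ and $H(\sigma),H(\sigma')\le K2^{-n\varepsilon}$. Put $$I_1=\{\sigma:-\rho\le\tfrac1n\langle\sigma,\sigma^*\rangle\le\rho\},\quad I_3=\{\sigma^*\},\quad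 \overline{I_3}=\{-\sigma^*\},\quad \partial S=\{\sigma: d_H(\sigma,\sigma^*)=1\},$$ where $d_H$ is the Hamming distance. **Theorem 3.4.** Let $\varepsilon\in(1/2,1)$. An OGP parameter for $\varepsilon$ exists. Let $\rho$ be any such parameter and let $\beta=\Omega(n2^{n\varepsilon})$, that is, $\beta_n\ge c_0\,n2^{n\varepsilon}$ for some constant $c_0>0$ and all large $n$. Then: (a) There is a deterministic sequence $\delta_n\to0$ such that w.h.p. $\pi_\beta(I_1\cup\overline{I_3})\ge\frac12(1+\delta_n)$. (b) There is a constant $c>0$ such that w.h.p. over $X$ the following holds. Let $(X_t)_{t\ge0}$ be any discrete-time Markov chain on $\mathcal B_n$ whose transition matrix $Q$ satisfies $Q(\sigma,\sigma')=0$ whenever $d_H(\sigma,\sigma')>1$ (holding in place is allowed) and is reversible with respect to $\pi_\beta$, started from $X_0\sim\pi_\beta(\cdot\mid I_3\cup\partial S)$, and let $\tau_\beta=\inf\{t:X_t\notin I_3\cup\partial S\}$ (with $\inf\varnothing=\infty$). Then, over the randomness of the chain, $$\mathbb P\bigl(\tau_\beta\ge\exp(c\,\beta_n2^{-n\varepsilon})\bigr)\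 \ge\ 1-\exp(-c\,\beta_n2^{-n\varepsilon}).$$ In particular, if $\beta=\omega(n2^{n\varepsilon})$, there is a constant $c>0$ such that w.h.p. over $X$, for all such chains, $\mathbb P(\tau_\beta\ge e^{cn})\ge1-e^{-cn}$. -/

import Mathlib

open Filter Topology MeasureTheory ProbabilityTheory
open scoped ENNReal Asymptotics

universe u

namespace NPP

/-- Spin configurations: the discrete cube `{-1, 1}^n`. -/
abbrev Spin (n : ℕ) : Type := Fin n → ℤˣ

/-- The law `N(0, I_n)` of the numbers to be partitioned. -/
noncomputable def gaussianVec (n : ℕ) : Measure (Fin n → ℝ) :=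
  Measure.pi fun _ => gaussianReal 0 1

/-- `E n X` holds with high probability as `n → ∞`, where `X ~ N(0, I_n)`. The (outer) measure of
the failure set is required to vanish, so that this is meaningful without measurability of `E`. -/
def WithHighProb (E : ∀ n : ℕ, (Fin n → ℝ) → Prop) : Prop :=
  Tendsto (fun n => gaussianVec n {x | ¬ E n x}) atTop (𝓝 0)

/-- The Hamiltonian `H(σ) = |⟨σ, X⟩| / √n`. -/
noncomputable def energy {n : ℕ} (x : Fin n → ℝ) (σ : Spin n) : ℝ :=
  |∑ i, ((σ i : ℤ) : ℝ) * x i| / √(n : ℝ)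

/-- `σ` is a ground state, that is, a minimizer of the Hamiltonian. -/
def IsGroundState {n : ℕ} (x : Fin n → ℝ) (σ : Spin n) : Prop :=
  ∀ σ' : Spin n, energy x σ ≤ energy x σ'

/-- The normalized inner product `⟨σ, σ'⟩ / n`. -/
noncomputable def innerBar {n : ℕ} (σ σ' : Spin n) : ℝ :=
  (∑ i, ((σ i : ℤ) : ℝ) * ((σ' i : ℤ) : ℝ)) / (n : ℝ)

/-- The partition function at inverse temperature `b`. -/
noncomputable def partitionFn {n : ℕ} (b : ℝ) (x : Fin n → ℝ) : ℝ :=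
  ∑ σ : Spin n, Real.exp (-b * energy x σ)

/-- The probability mass function of the Gibbs measure at inverse temperature `b`. -/
noncomputable def gibbs {n : ℕ} (b : ℝ) (x : Fin n → ℝ) (σ : Spin n) : ℝ :=
  Real.exp (-b * energy x σ) / partitionFn b x

/-- The Gibbs mass of a set of spin configurations. -/
noncomputable def gibbsMass {n : ℕ} (b : ℝ) (x : Fin n → ℝ) (A : Set (Spin n)) : ℝ :=
  ∑ σ : Spin n, A.indicator (gibbs b x) σ

/-- The Gibbs measure conditioned on a set `A`, as a probability mass function. -/
noncomputable def gibbsCond {n : ℕ} (b : ℝ) (x : Fin n → ℝ) (A : Set (Spin n)) (σ : Spin n) : ℝ :=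
  A.indicator (gibbs b x) σ / gibbsMass b x A

/-- `ρ ∈ (0, 1)` is a parameter for which the overlap gap property for pairs holds at energy levels
`O(2^{-nε})`: for every constant `K`, with probability at least `1 - exp(-Ω(n))` there is no pair
`σ, σ'` of energies at most `K 2^{-nε}` with overlap `|⟨σ, σ'⟩| / n` in `[ρ, (n-2)/n]`. -/
def IsOGPParameter (ε ρ : ℝ) : Prop :=
  ρ ∈ Set.Ioo (0 : ℝ) 1 ∧
  ∀ K : ℝ, 0 < K → ∃ c : ℝ, 0 < c ∧ ∀ᶠ n : ℕ in atTop,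
    gaussianVec n {x | ∃ σ σ' : Spin n,
        |innerBar σ σ'| ∈ Set.Icc ρ (((n : ℝ) - 2) / n) ∧
        energy x σ ≤ K * (2 : ℝ) ^ (-(n * ε)) ∧
        energy x σ' ≤ K * (2 : ℝ) ^ (-(n * ε))}
      ≤ ENNReal.ofReal (Real.exp (-(c * n)))

/-- The set `I₁` of configurations with small inner product with `σs`. -/
def I₁ {n : ℕ} (ρ : ℝ) (σs : Spin n) : Set (Spin n) :=
  {σ | -ρ ≤ innerBar σ σs ∧ innerBar σ σs ≤ ρ}

/-- `I₃ = {σs}`. -/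
def I₃ {n : ℕ} (σs : Spin n) : Set (Spin n) := {σs}

/-- The reflection `{-σs}` of `I₃`. -/
def I₃bar {n : ℕ} (σs : Spin n) : Set (Spin n) := {-σs}

/-- The set `∂S` of configurations at Hamming distance one from `σs`. -/
def bdryS {n : ℕ} (σs : Spin n) : Set (Spin n) := {σ | hammingDist σ σs = 1}

/-- `Q` is the transition matrix of a nearest-neighbour Markov chain on the hypercube (holding in
place is allowed) which is reversible with respect to `π`. -/
structure IsReversibleNearestNeighbour {n : ℕ} (π : Spin n → ℝ) (Q : Spin n → Spin n → ℝ) :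
    Prop where
  nonneg : ∀ σ σ', 0 ≤ Q σ σ'
  sum_eq_one : ∀ σ, ∑ σ', Q σ σ' = 1
  nearest : ∀ σ σ', 1 < hammingDist σ σ' → Q σ σ' = 0
  reversible : ∀ σ σ', π σ * Q σ σ' = π σ' * Q σ' σ

/-- The process `Y` on `(Ω, P)` is a discrete time Markov chain with initial law `ν` and
transition matrix `Q`. -/
structure IsMarkovChain {n : ℕ} (ν : Spin n → ℝ) (Q : Spin n → Spin n → ℝ)
    {Ω : Type u} [MeasurableSpace Ω] (P : Measure Ω) (Y : ℕ → Ω → Spin n) : Prop where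
  measurable : ∀ t σ, MeasurableSet {ω | Y t ω = σ}
  law : ∀ (t : ℕ) (s : ℕ → Spin n),
    P {ω | ∀ i, i ≤ t → Y i ω = s i}
      = ENNReal.ofReal (ν (s 0) * ∏ i ∈ Finset.range t, Q (s i) (s (i + 1)))

/-- The first time at which the process is outside `A`; it is `⊤` if this never happens. -/
noncomputable def exitTime {n : ℕ} {Ω : Type u} (A : Set (Spin n)) (Y : ℕ → Ω → Spin n) (ω : Ω) :
    ℕ∞ :=
  ⨅ (t : ℕ) (_ : Y t ω ∉ A), (t : ℕ∞)

/-- For every ground state `σs` of the instance `x`, and every nearest-neighbour Markov chain that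
is reversible for the Gibbs measure at inverse temperature `b` and is started from the Gibbs measure
conditioned on `I₃ ∪ ∂S`, the escape time from `I₃ ∪ ∂S` is at least `exp r`, except with
probability at most `exp (-r)` over the chain. -/
def SlowEscape {n : ℕ} (b : ℝ) (x : Fin n → ℝ) (r : ℝ) : Prop :=
  ∀ σs : Spin n, IsGroundState x σs →
  ∀ Q : Spin n → Spin n → ℝ, IsReversibleNearestNeighbour (gibbs b x) Q →
  ∀ (Ω : Type u) [MeasurableSpace Ω] (P : Measure Ω) [IsProbabilityMeasure P]
    (Y : ℕ → Ω → Spin n), IsMarkovChain (gibbsCond b x (I₃ σs ∪ bdryS σs)) Q P Y →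
    P {ω | (exitTime (I₃ σs ∪ bdryS σs) Y ω : ℝ≥0∞) < ENNReal.ofReal (Real.exp r)}
      ≤ ENNReal.ofReal (Real.exp (-r))

end NPP

/-!
The theorem follows from a gap statement: with high probability every ground state `σs` has energy
at most `2 ^ (-nε)`, while every configuration other than `±σs` whose overlap with `σs` is at least
`ρ` in absolute value has energy at least `K 2 ^ (-nε)`, for a constant `K` of our choice
(`withHighProb_gap`). Write `θ = β 2 ^ (-nε)`. Since `n = O(θ)`, a large `K` makes the energetic
cost `(K - 1) θ` beat the entropy `n log 2`, so that all the close configurations together have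
Gibbs mass at most `exp (-3θ)` times that of `σs` (`gibbsMass_closeSet_le`).

* For (a), what is left outside `I₁ ∪ {-σs}` is `σs`, of mass at most `1/2` because `σs` and `-σs`
  have equal mass, and the close configurations (`half_sub_le_gibbsMass`).
* For (b), `∂S` consists of close configurations, and a nearest-neighbour chain can only leave
  `I₃ ∪ ∂S` from `∂S`. By reversibility the chain started from the conditioned Gibbs measure is
  dominated at all times by the multiple `gibbs / gibbsMass (I₃ ∪ ∂S)`, so it escapes within
  `exp θ` steps with probability at most `exp θ * exp (-3θ)`
  (`IsMarkovChain.measure_exitTime_lt_le`, `slowEscape_of_gibbsMass_bdryS_le`).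

The upper bound on the ground state energy is a second moment argument, and the existence of an
overlap gap parameter a first moment one. Both rest on `prob_pair_le`: at Hamming distance `d` the
two signed sums are `U + V` and `U - V` for independent centred Gaussians `U`, `V` of variances
`n - d` and `d`, whose joint density is at most `1 / (2π √(d (n - d)))`. In the second moment this
bound exceeds the product of the marginals by a factor close to `(1 - r²)^(-1/2) ≤ 1 + √n r²`, `r`
being the overlap, and `r²` has mean `1 / n` over the cube (`prob_no_small_sum_le`). In the first
moment, the number of pairs with overlap at least `ρ` is controlled by an exponential Markov bound,
whose rate can be made arbitrarily close to `log 2` by taking `ρ` close to `1`; as `ε > 1/2`, the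
factor `2 ^ (-2nε)` wins (`exists_overlap_rate_lt_one`, `exists_isOGPParameter`).
-/

namespace NPP

/-! ### Small-ball probabilities for pairs of signed Gaussian sums -/

/-- The signed sum `⟨σ, x⟩`. -/
noncomputable def signedSum {n : ℕ} (x : Fin n → ℝ) (σ : Spin n) : ℝ :=
  ∑ i, ((σ i : ℤ) : ℝ) * x i

instance (n : ℕ) : IsProbabilityMeasure (gaussianVec n) := by
  unfold gaussianVec; infer_instance

lemma measurable_signedSum {n : ℕ} (σ : Spin n) : Measurable fun x => signedSum x σ := by
  unfold signedSum; fun_prop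

lemma spin_sq (u : ℤˣ) : ((u : ℤ) : ℝ) ^ 2 = 1 := by
  rcases Int.units_eq_one_or u with rfl | rfl <;> simp

lemma map_signed_coord {n : ℕ} (σ : Spin n) (i : Fin n) :
    (gaussianVec n).map (fun x => ((σ i : ℤ) : ℝ) * x i) = gaussianReal 0 1 := by
  have h : HasLaw (fun x : Fin n → ℝ => x i) (gaussianReal 0 1) (gaussianVec n) :=
    ⟨(measurable_pi_apply i).aemeasurable,
      (measurePreserving_eval (fun _ : Fin n => gaussianReal 0 1) i).map_eq⟩
  rw [(gaussianReal_const_mul h _).map_eq]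
  congr 1
  · simp
  · ext; simp [spin_sq]

lemma iIndepFun_signed_coord {n : ℕ} (σ : Spin n) :
    iIndepFun (fun i (x : Fin n → ℝ) => ((σ i : ℤ) : ℝ) * x i) (gaussianVec n) :=
  iIndepFun_pi (X := fun i (y : ℝ) => ((σ i : ℤ) : ℝ) * y) fun _ => by fun_prop

lemma map_sum_signed_coord {n : ℕ} (σ : Spin n) (s : Finset (Fin n)) :
    (gaussianVec n).map (fun x => ∑ i ∈ s, ((σ i : ℤ) : ℝ) * x i) = gaussianReal 0 s.card := by
  induction s using Finset.induction_on with
  | empty => simp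
  | insert a s ha ih =>
    have h := gaussianReal_add_gaussianReal_of_indepFun
      ((iIndepFun_signed_coord σ).indepFun_finsetSum_of_notMem (fun i => by fun_prop) ha)
      (by convert ih using 2; ext x; simp) (map_signed_coord σ a)
    convert h using 2
    · ext x; simp [Finset.sum_insert ha, add_comm]
    · simp
    · simp [Finset.card_insert_of_notMem ha]

lemma map_signedSum {n : ℕ} (σ : Spin n) :
    (gaussianVec n).map (fun x => signedSum x σ) = gaussianReal 0 n := by
  simpa [signedSum] using map_sum_signed_coord σ Finset.univ

lemma gaussianReal_le_smul_volume {v : NNReal} (hv : v ≠ 0) :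
    gaussianReal 0 v ≤ ENNReal.ofReal (√(2 * Real.pi * v))⁻¹ • volume := by
  rw [gaussianReal_of_var_ne_zero _ hv, ← withDensity_const]
  refine withDensity_mono (ae_of_all _ fun x => ?_)
  refine ENNReal.ofReal_le_ofReal ?_
  rw [gaussianPDFReal]
  refine mul_le_of_le_one_right (by positivity) ?_
  rw [Real.exp_le_one_iff]
  exact div_nonpos_of_nonpos_of_nonneg (neg_nonpos.2 (sq_nonneg _)) (by positivity)

lemma le_gaussianReal_Icc {v : NNReal} (hv : v ≠ 0) {A : ℝ} (hA : 0 ≤ A) :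
    2 * A * ((√(2 * Real.pi * v))⁻¹ * Real.exp (-A ^ 2 / (2 * v)))
      ≤ (gaussianReal 0 v).real (Set.Icc (-A) A) := by
  rw [measureReal_def, gaussianReal_apply_eq_integral _ hv, ENNReal.toReal_ofReal
    (integral_nonneg fun x => gaussianPDFReal_nonneg _ _ _)]
  have h : ∫ _ in Set.Icc (-A) A, ((√(2 * Real.pi * v))⁻¹ * Real.exp (-A ^ 2 / (2 * v)))
      = 2 * A * ((√(2 * Real.pi * v))⁻¹ * Real.exp (-A ^ 2 / (2 * v))) := by
    rw [setIntegral_const, measureReal_def, Real.volume_Icc, ENNReal.toReal_ofReal (by linarith),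
      smul_eq_mul]
    ring
  rw [← h]
  refine setIntegral_mono_on (integrableOn_const (by simp))
    (integrable_gaussianPDFReal _ _).integrableOn
    measurableSet_Icc fun x hx => ?_
  rw [gaussianPDFReal]
  gcongr _ * Real.exp (-?_ / _)
  rw [sub_zero]
  exact sq_le_sq' hx.1 hx.2

lemma lintegral_tent {A : ℝ} (hA : 0 ≤ A) :
    ∫⁻ u : ℝ, ENNReal.ofReal (2 * (A - |u|)) = ENNReal.ofReal (2 * A ^ 2) := by
  have h1 : ∫⁻ u : ℝ, ENNReal.ofReal (2 * (A - |u|))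
      = ∫⁻ u in Set.Ioc (-A) A, ENNReal.ofReal (2 * (A - |u|)) := by
    rw [← lintegral_indicator measurableSet_Ioc]
    refine lintegral_congr fun u => ?_
    by_cases hu : u ∈ Set.Ioc (-A) A
    · simp [hu]
    · rw [Set.indicator_of_notMem hu, ENNReal.ofReal_eq_zero]
      by_contra! h
      have := abs_lt.1 (show |u| < A by linarith)
      exact hu ⟨this.1, this.2.le⟩
  have hc : Continuous fun u : ℝ => 2 * (A - |u|) := by fun_prop
  rw [h1, ← ofReal_integral_eq_lintegral_ofReal]
  · rw [← intervalIntegral.integral_of_le (by linarith),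
      ← intervalIntegral.integral_add_adjacent_intervals (b := 0) (hc.intervalIntegrable _ _)
        (hc.intervalIntegrable _ _)]
    have e1 : ∫ u in (-A)..0, 2 * (A - |u|) = ∫ u in (-A)..0, 2 * (A + u) := by
      refine intervalIntegral.integral_congr fun u hu => ?_
      rw [Set.uIcc_of_le (by linarith)] at hu
      simp only [abs_of_nonpos hu.2]; ring
    have e2 : ∫ u in (0 : ℝ)..A, 2 * (A - |u|) = ∫ u in (0 : ℝ)..A, 2 * (A - u) := by
      refine intervalIntegral.integral_congr fun u hu => ?_
      rw [Set.uIcc_of_le hA] at hu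
      simp only [abs_of_nonneg hu.1]
    rw [e1, e2]
    simp only [intervalIntegral.integral_const_mul]
    rw [intervalIntegral.integral_add (by simp) (by simp),
      intervalIntegral.integral_sub (by simp) (by simp)]
    simp only [intervalIntegral.integral_const, integral_id, smul_eq_mul]
    congr 1
    ring
  · exact (hc.integrableOn_Icc (a := -A) (b := A)).mono_set Set.Ioc_subset_Icc_self
  · refine (ae_restrict_iff' measurableSet_Ioc).2 (ae_of_all _ fun u hu => ?_)
    have := abs_le.2 ⟨hu.1.le, hu.2⟩
    simp only [Pi.zero_apply]; linarith

lemma measurableSet_diamond (A : ℝ) :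
    MeasurableSet {z : ℝ × ℝ | |z.1 + z.2| ≤ A ∧ |z.1 - z.2| ≤ A} := by
  have h1 : Measurable fun z : ℝ × ℝ => |z.1 + z.2| := (measurable_fst.add measurable_snd).abs
  have h2 : Measurable fun z : ℝ × ℝ => |z.1 - z.2| := (measurable_fst.sub measurable_snd).abs
  exact (measurableSet_le h1 measurable_const).inter (measurableSet_le h2 measurable_const)

/-- Two independent centred Gaussians of variances `v` and `w` have a joint density bounded by
`1 / (2π √(v w))`, and the square `|u + w|, |u - w| ≤ A` has area `2 A ^ 2`. -/
lemma gaussian_prod_diamond_le {v w : NNReal} (hv : v ≠ 0) (hw : w ≠ 0) {A : ℝ} (hA : 0 ≤ A) :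
    ((gaussianReal 0 v).prod (gaussianReal 0 w)) {z | |z.1 + z.2| ≤ A ∧ |z.1 - z.2| ≤ A}
      ≤ ENNReal.ofReal (A ^ 2 / (Real.pi * √(v * w))) := by
  have hms := measurableSet_diamond A
  rw [Measure.prod_apply hms]
  set a := (√(2 * Real.pi * v))⁻¹
  set b := (√(2 * Real.pi * w))⁻¹
  calc _ ≤ ∫⁻ u, ENNReal.ofReal b * ENNReal.ofReal (2 * (A - |u|)) ∂gaussianReal 0 v := by
        refine lintegral_mono fun u => ?_
        refine (gaussianReal_le_smul_volume hw _).trans ?_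
        rw [Measure.smul_apply, smul_eq_mul]
        gcongr
        have : Prod.mk u ⁻¹' {z : ℝ × ℝ | |z.1 + z.2| ≤ A ∧ |z.1 - z.2| ≤ A}
            ⊆ Set.Icc (-(A - |u|)) (A - |u|) := by
          rintro y ⟨h1, h2⟩
          simp only at h1 h2
          rw [abs_le] at h1 h2
          constructor <;> cases abs_cases u <;> linarith
        refine (measure_mono this).trans ?_
        rw [Real.volume_Icc]
        exact ENNReal.ofReal_le_ofReal (by linarith)
    _ ≤ ∫⁻ u, ENNReal.ofReal b * ENNReal.ofReal (2 * (A - |u|))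
          ∂(ENNReal.ofReal a • (volume : Measure ℝ)) :=
        lintegral_mono' (gaussianReal_le_smul_volume hv) le_rfl
    _ = ENNReal.ofReal (A ^ 2 / (Real.pi * √(v * w))) := by
        rw [lintegral_smul_measure, lintegral_const_mul _ (by fun_prop), lintegral_tent hA,
          smul_eq_mul, ← ENNReal.ofReal_mul (by positivity), ← ENNReal.ofReal_mul (by positivity)]
        congr 1
        have hv' : (0 : ℝ) < v := by positivity
        have hw' : (0 : ℝ) < w := by positivity
        have : √(2 * Real.pi * v) * √(2 * Real.pi * w) = 2 * Real.pi * √(v * w) := by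
          rw [← Real.sqrt_mul (by positivity),
            show 2 * Real.pi * v * (2 * Real.pi * w) = (2 * Real.pi) ^ 2 * (v * w) by ring,
            Real.sqrt_mul (by positivity), Real.sqrt_sq (by positivity)]
        calc a * (b * (2 * A ^ 2)) = 2 * A ^ 2 / (√(2 * Real.pi * v) * √(2 * Real.pi * w)) := by
              simp only [a, b]; field_simp
          _ = _ := by rw [this]; field_simp

lemma measurableSet_signedSum_le {n : ℕ} (σ : Spin n) (A : ℝ) :
    MeasurableSet {x : Fin n → ℝ | |signedSum x σ| ≤ A} :=
  measurableSet_le (measurable_signedSum σ).abs measurable_const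

lemma prob_abs_signedSum_le {n : ℕ} (σ : Spin n) (A : ℝ) :
    (gaussianVec n).real {x | |signedSum x σ| ≤ A}
      = (gaussianReal 0 n).real (Set.Icc (-A) A) := by
  rw [← map_signedSum σ, map_measureReal_apply (measurable_signedSum σ) measurableSet_Icc]
  congr 1; ext x; simp [abs_le]

/-- The signed sums of two configurations at Hamming distance `d` are `U + V` and `U - V`, where
`U` and `V` collect the coordinates of agreement and of disagreement; these are independent
centred Gaussians of variances `n - d` and `d`. -/
lemma prob_pair_le {n : ℕ} {σ σ' : Spin n} (h0 : 0 < hammingDist σ σ') (h1 : hammingDist σ σ' < n)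
    {A : ℝ} (hA : 0 ≤ A) :
    (gaussianVec n).real {x | |signedSum x σ| ≤ A ∧ |signedSum x σ'| ≤ A}
      ≤ A ^ 2 / (Real.pi * √((n - hammingDist σ σ') * hammingDist σ σ')) := by
  set s : Finset (Fin n) := {i | σ i = σ' i} with hs
  set t : Finset (Fin n) := {i | σ i ≠ σ' i} with ht
  have hst : Disjoint s t := Finset.disjoint_filter_filter_not _ _ _
  have htc : t.card = hammingDist σ σ' := rfl
  have hsc : s.card = n - hammingDist σ σ' := by
    have : s.card + t.card = n := by
      simpa using Finset.card_filter_add_card_filter_not (s := (Finset.univ : Finset (Fin n)))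
        (fun i => σ i = σ' i)
    omega
  set U : (Fin n → ℝ) → ℝ := fun x => ∑ i ∈ s, ((σ i : ℤ) : ℝ) * x i
  set V : (Fin n → ℝ) → ℝ := fun x => ∑ i ∈ t, ((σ i : ℤ) : ℝ) * x i
  have hUm : Measurable U := by fun_prop
  have hVm : Measurable V := by fun_prop
  have hUV : IndepFun U V (gaussianVec n) := by
    have := (iIndepFun_signed_coord σ).indepFun_finset s t hst (fun i => by fun_prop)
    have h2 := this.comp (φ := fun y : s → ℝ => ∑ i, y i) (ψ := fun y : t → ℝ => ∑ i, y i)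
      (by fun_prop) (by fun_prop)
    convert h2 using 1
    · ext x; exact (Finset.sum_coe_sort s (fun i => ((σ i : ℤ) : ℝ) * x i)).symm
    · ext x; exact (Finset.sum_coe_sort t (fun i => ((σ i : ℤ) : ℝ) * x i)).symm
  have hmap := (indepFun_iff_map_prod_eq_prod_map_map hUm.aemeasurable hVm.aemeasurable).1 hUV
  rw [map_sum_signed_coord, map_sum_signed_coord] at hmap
  have e1 : ∀ x, signedSum x σ = U x + V x := fun x =>
    (Finset.sum_filter_add_sum_filter_not _ _ _).symm
  have e2 : ∀ x, signedSum x σ' = U x - V x := fun x => by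
    have h3 := (Finset.sum_filter_add_sum_filter_not Finset.univ (fun i => σ i = σ' i)
      (fun i => ((σ' i : ℤ) : ℝ) * x i)).symm
    rw [signedSum, h3, sub_eq_add_neg]
    congr 1
    · refine Finset.sum_congr rfl fun i hi => ?_
      rw [(Finset.mem_filter.1 hi).2]
    · rw [← Finset.sum_neg_distrib]
      refine Finset.sum_congr rfl fun i hi => ?_
      have h4 : σ' i = -σ i := by
        have := (Finset.mem_filter.1 hi).2
        rcases Int.units_eq_one_or (σ i) with h | h <;>
          rcases Int.units_eq_one_or (σ' i) with h' | h' <;> simp_all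
      rw [h4]; simp
  have hms := measurableSet_diamond A
  have key : gaussianVec n {x | |signedSum x σ| ≤ A ∧ |signedSum x σ'| ≤ A}
      = ((gaussianReal 0 s.card).prod (gaussianReal 0 t.card))
        {z | |z.1 + z.2| ≤ A ∧ |z.1 - z.2| ≤ A} := by
    rw [← hmap, Measure.map_apply (hUm.prodMk hVm) hms]
    simp only [e1, e2]
    rfl
  rw [measureReal_def, key]
  refine ENNReal.toReal_le_of_le_ofReal (by positivity) ?_
  refine (gaussian_prod_diamond_le (Nat.cast_ne_zero.2 (by omega))
    (Nat.cast_ne_zero.2 (by omega)) hA).trans ?_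
  rw [hsc, htc]
  rw [NNReal.coe_natCast, NNReal.coe_natCast, Nat.cast_sub h1.le]

/-! ### Overlaps on the cube -/

lemma card_spin (n : ℕ) : (Fintype.card (Spin n) : ℝ) = 2 ^ n := by
  simp [Spin]

lemma sum_mul_eq_sub_hammingDist {n : ℕ} (σ σ' : Spin n) :
    ∑ i, ((σ i : ℤ) : ℝ) * ((σ' i : ℤ) : ℝ) = n - 2 * hammingDist σ σ' := by
  have h : ∀ i, ((σ i : ℤ) : ℝ) * ((σ' i : ℤ) : ℝ) = 1 - 2 * (if σ i ≠ σ' i then 1 else 0) := by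
    intro i
    rcases Int.units_eq_one_or (σ i) with h | h <;>
      rcases Int.units_eq_one_or (σ' i) with h' | h' <;> simp [h, h'] <;> norm_num
  simp only [h, Finset.sum_sub_distrib, ← Finset.mul_sum, Finset.sum_boole]
  simp [hammingDist]

lemma innerBar_eq {n : ℕ} (σ σ' : Spin n) :
    innerBar σ σ' = (n - 2 * hammingDist σ σ') / n := by
  rw [innerBar, sum_mul_eq_sub_hammingDist]

lemma innerBar_comm {n : ℕ} (σ σ' : Spin n) : innerBar σ σ' = innerBar σ' σ := by
  rw [innerBar_eq, innerBar_eq, hammingDist_comm]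

lemma eq_neg_of_hammingDist_eq {n : ℕ} {σ σ' : Spin n} (h : hammingDist σ σ' = n) : σ' = -σ := by
  have h1 : ({i | σ i ≠ σ' i} : Finset (Fin n)) = Finset.univ := by
    rw [← Finset.card_eq_iff_eq_univ]; simpa [hammingDist] using h
  ext i : 1
  have h2 : σ i ≠ σ' i := by
    have := Finset.mem_univ i
    rw [← h1] at this
    exact (Finset.mem_filter.1 this).2
  rcases Int.units_eq_one_or (σ i) with h | h <;>
    rcases Int.units_eq_one_or (σ' i) with h' | h' <;> simp_all

lemma hammingDist_lt_of_ne_neg {n : ℕ} {σ σ' : Spin n} (h : σ' ≠ -σ) : hammingDist σ σ' < n :=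
  lt_of_le_of_ne (by simpa using hammingDist_le_card_fintype (x := σ) (y := σ'))
    fun h' => h (eq_neg_of_hammingDist_eq h')

lemma abs_innerBar_le {n : ℕ} {σ σ' : Spin n} (h0 : σ' ≠ σ) (h1 : σ' ≠ -σ) :
    |innerBar σ σ'| ≤ ((n : ℝ) - 2) / n := by
  have hd : 1 ≤ hammingDist σ σ' := hammingDist_pos.2 h0.symm
  have hd' := hammingDist_lt_of_ne_neg h1
  have hd1 : (1 : ℝ) ≤ hammingDist σ σ' := by exact_mod_cast hd
  have hd2 : (hammingDist σ σ' : ℝ) + 1 ≤ n := by exact_mod_cast hd'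
  rw [innerBar_eq, abs_div, Nat.abs_cast]
  gcongr
  rw [abs_le]; constructor <;> linarith

lemma sum_mul_coord_eq_zero {n : ℕ} {i j : Fin n} (hij : i ≠ j) :
    ∑ σ : Spin n, ((σ i : ℤ) : ℝ) * ((σ j : ℤ) : ℝ) = 0 := by
  have h := Equiv.sum_comp (Equiv.mulLeft (Pi.mulSingle i (-1) : Spin n))
    (fun σ : Spin n => ((σ i : ℤ) : ℝ) * ((σ j : ℤ) : ℝ))
  simp only [Equiv.coe_mulLeft, Pi.mul_apply, Pi.mulSingle_eq_same,
    Pi.mulSingle_eq_of_ne hij.symm, one_mul] at h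
  simp only [neg_mul, one_mul, Units.val_neg, Int.cast_neg, Finset.sum_neg_distrib] at h
  linarith

/-- The squared overlap of a fixed configuration with a uniform one has mean `1 / n`. -/
lemma sum_innerBar_sq {n : ℕ} (hn : n ≠ 0) (σ : Spin n) :
    ∑ σ' : Spin n, innerBar σ σ' ^ 2 = 2 ^ n / n := by
  have h : ∑ σ' : Spin n, (∑ i, ((σ i : ℤ) : ℝ) * ((σ' i : ℤ) : ℝ)) ^ 2 = n * 2 ^ n := by
    simp only [sq, Finset.sum_mul_sum]
    rw [Finset.sum_comm]
    calc _ = ∑ i : Fin n, (2 : ℝ) ^ n := by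
          refine Finset.sum_congr rfl fun i _ => ?_
          rw [Finset.sum_comm, Finset.sum_eq_single i]
          · have : ∀ σ' : Spin n, ((σ i : ℤ) : ℝ) * ((σ' i : ℤ) : ℝ) *
                (((σ i : ℤ) : ℝ) * ((σ' i : ℤ) : ℝ)) = 1 := fun σ' => by
              rw [← sq, mul_pow, spin_sq, spin_sq, one_mul]
            simp only [this]
            simp
          · intro j _ hj
            have := sum_mul_coord_eq_zero hj.symm
            calc _ = ∑ σ' : Spin n, ((σ i : ℤ) : ℝ) * ((σ j : ℤ) : ℝ) *
                  (((σ' i : ℤ) : ℝ) * ((σ' j : ℤ) : ℝ)) :=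
                  Finset.sum_congr rfl fun _ _ => by ring
              _ = 0 := by rw [← Finset.mul_sum, this, mul_zero]
          · simp
      _ = _ := by simp
  simp only [innerBar, div_pow, ← Finset.sum_div, h]
  field_simp

lemma sum_exp_mul_overlap {n : ℕ} (σ : Spin n) (l : ℝ) :
    ∑ σ' : Spin n, Real.exp (l * ∑ i, ((σ i : ℤ) : ℝ) * ((σ' i : ℤ) : ℝ))
      = (Real.exp l + Real.exp (-l)) ^ n := by
  have h : ∀ i : Fin n, ∑ v : ℤˣ, Real.exp (l * (((σ i : ℤ) : ℝ) * ((v : ℤ) : ℝ)))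
      = Real.exp l + Real.exp (-l) := fun i => by
    rcases Int.units_eq_one_or (σ i) with h | h <;> simp [h, add_comm]
  simp only [Finset.mul_sum, Real.exp_sum]
  rw [← Fintype.prod_sum (fun i (v : ℤˣ) => Real.exp (l * (((σ i : ℤ) : ℝ) * ((v : ℤ) : ℝ))))]
  rw [Finset.prod_congr rfl fun i _ => h i]
  simp

/-! ### Second moment bound for the ground state energy -/

/-- Chebyshev's inequality for the number of events that occur. -/
lemma prob_none_le_second_moment {Ω ι : Type*} [MeasurableSpace Ω] [Fintype ι] (P : Measure Ω)
    [IsProbabilityMeasure P] {E : ι → Set Ω} (hE : ∀ i, MeasurableSet (E i))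
    (hpos : 0 < ∑ i, P.real (E i)) :
    P.real {ω | ∀ i, ω ∉ E i} ≤
      (∑ i, ∑ j, P.real (E i ∩ E j)) / (∑ i, P.real (E i)) ^ 2 - 1 := by
  set m := ∑ i, P.real (E i)
  set N : Ω → ℝ := fun ω => ∑ i, (E i).indicator 1 ω with hN
  have hint : ∀ s : Set Ω, MeasurableSet s → Integrable (s.indicator (1 : Ω → ℝ)) P := fun s hs =>
    (integrable_const (1 : ℝ)).indicator hs
  have hNi : Integrable N P := integrable_finsetSum _ fun i _ => hint _ (hE i)
  have hN2 : ∀ ω, N ω ^ 2 = ∑ i, ∑ j, (E i ∩ E j).indicator (1 : Ω → ℝ) ω := fun ω => by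
    simp only [hN, sq, Finset.sum_mul_sum, Set.inter_indicator_one, Pi.mul_apply]
  have hN2i : Integrable (fun ω => N ω ^ 2) P := by
    simp only [hN2]
    exact integrable_finsetSum _ fun i _ => integrable_finsetSum _ fun j _ =>
      hint _ ((hE i).inter (hE j))
  have e1 : ∫ ω, N ω ∂P = m := by
    rw [integral_finsetSum _ fun i _ => hint _ (hE i)]
    simp [m, integral_indicator_one, hE]
  have e2 : ∫ ω, N ω ^ 2 ∂P = ∑ i, ∑ j, P.real (E i ∩ E j) := by
    simp only [hN2]
    rw [integral_finsetSum _ fun i _ => integrable_finsetSum _ fun j _ =>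
      hint _ ((hE i).inter (hE j))]
    refine Finset.sum_congr rfl fun i _ => ?_
    rw [integral_finsetSum _ fun j _ => hint _ ((hE i).inter (hE j))]
    exact Finset.sum_congr rfl fun j _ => integral_indicator_one ((hE i).inter (hE j))
  have hms : MeasurableSet {ω | ∀ i, ω ∉ E i} := by
    rw [Set.ofPred_forall]
    exact MeasurableSet.iInter fun i => (hE i).compl
  have hi2 : Integrable (fun ω => N ω ^ 2 - 2 * m * N ω) P := hN2i.sub (hNi.const_mul _)
  have hle : ∫ ω, m ^ 2 * {ω | ∀ i, ω ∉ E i}.indicator 1 ω ∂P ≤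
      ∫ ω, (N ω ^ 2 - 2 * m * N ω + m ^ 2) ∂P := by
    refine integral_mono ((hint _ hms).const_mul _)
      (hi2.add (integrable_const _)) fun ω => ?_
    by_cases h : ω ∈ {ω | ∀ i, ω ∉ E i}
    · have h0 : N ω = 0 := Finset.sum_eq_zero fun i _ => Set.indicator_of_notMem (h i) _
      simp [Set.indicator_of_mem h, h0]
    · simp only [Set.indicator_of_notMem h, mul_zero]
      nlinarith [sq_nonneg (N ω - m)]
  rw [integral_const_mul, integral_indicator_one hms, integral_add hi2 (integrable_const _),
    integral_sub hN2i (hNi.const_mul _), integral_const_mul, e1, e2] at hle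
  simp only [integral_const, probReal_univ, one_smul] at hle
  rw [le_sub_iff_add_le, le_div_iff₀ (by positivity)]
  linarith

/-- The ratio `(1 - r²)^(-1/2)` for the overlap `r = (n - 2d) / n` exceeds one by at most
`√n r²`, because `1 - r² ≥ 1 / n` whenever `0 < d < n`. -/
lemma density_ratio_le {n d : ℝ} (hd : 1 ≤ d) (hdn : d + 1 ≤ n) :
    n / (2 * √((n - d) * d)) ≤ 1 + √n * ((n - 2 * d) / n) ^ 2 := by
  have hn : 0 < n := by linarith
  set s := ((n - 2 * d) / n) ^ 2 with hs
  have hs1 : 1 - s = 4 * ((n - d) * d) / n ^ 2 := by rw [hs]; field_simp; ring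
  have hq : n - 1 ≤ (n - d) * d := by nlinarith
  have hsn : 1 / n ≤ 1 - s := by
    rw [hs1, div_le_div_iff₀ hn (by positivity)]
    nlinarith
  have hw : √(1 - s) = 2 * √((n - d) * d) / n := by
    rw [hs1, Real.sqrt_div' _ (by positivity), Real.sqrt_sq hn.le,
      show 4 * ((n - d) * d) = 2 ^ 2 * ((n - d) * d) by ring, Real.sqrt_mul (by positivity),
      Real.sqrt_sq (by norm_num)]
  set w := √(1 - s)
  have hw0 : 0 < w := Real.sqrt_pos.2 (lt_of_lt_of_le (by positivity) hsn)
  have hw2 : w ^ 2 = 1 - s := Real.sq_sqrt (le_trans (by positivity) hsn)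
  have hs0 : 0 ≤ s := sq_nonneg _
  have hw1 : w ≤ 1 := by nlinarith
  have hwn : 1 / w ≤ √n := by
    rw [one_div, ← Real.sqrt_inv]
    refine Real.sqrt_le_sqrt ?_
    rw [inv_le_comm₀ (lt_of_lt_of_le (by positivity) hsn) hn]
    simpa using hsn
  calc n / (2 * √((n - d) * d)) = 1 / w := by rw [hw]; field_simp
    _ ≤ 1 + 1 / w * s := by
      rw [div_mul_eq_mul_div, one_mul, div_le_iff₀ hw0, add_mul, div_mul_cancel₀ _ hw0.ne']
      nlinarith
    _ ≤ _ := by gcongr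

/-- Second moment method for the number of configurations with `|signedSum x σ| ≤ √n a`. The right
hand side is a bound on the excess over `1` of the second moment divided by the squared mean; its
second summand comes from the diagonal pairs `σ' = ±σ`. -/
lemma prob_no_small_sum_le {n : ℕ} (hn : n ≠ 0) {a : ℝ} (ha : 0 < a) :
    (gaussianVec n).real {x | ∀ σ : Spin n, ¬ |signedSum x σ| ≤ √n * a} ≤
      Real.exp (a ^ 2) * (1 + (√n)⁻¹) + √(2 * Real.pi) * Real.exp (a ^ 2 / 2) / (2 ^ n * a) - 1 := by
  have hn0 : (0 : ℝ) < n := by positivity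
  have hsq : √(n : ℝ) ^ 2 = n := Real.sq_sqrt hn0.le
  set A := √(n : ℝ) * a with hA
  set p := (gaussianReal 0 n).real (Set.Icc (-A) A)
  have hlow : 2 * a / √(2 * Real.pi) * Real.exp (-(a ^ 2 / 2)) ≤ p := by
    have h := le_gaussianReal_Icc (v := n) (by positivity) (A := A) (by positivity)
    refine le_trans (le_of_eq ?_) h
    rw [NNReal.coe_natCast, Real.sqrt_mul (by positivity) (n : ℝ), hA, mul_pow, hsq]
    have : -(n * a ^ 2) / (2 * (n : ℝ)) = -(a ^ 2 / 2) := by field_simp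
    rw [this]
    field_simp
  have hp : 0 < p := lt_of_lt_of_le (by positivity) hlow
  set E : Spin n → Set (Fin n → ℝ) := fun σ => {x | |signedSum x σ| ≤ A}
  have hEp : ∀ σ, (gaussianVec n).real (E σ) = p := fun σ => prob_abs_signedSum_le σ A
  have hsum : ∑ σ, (gaussianVec n).real (E σ) = 2 ^ n * p := by
    simp only [hEp, Finset.sum_const, nsmul_eq_mul, Finset.card_univ, card_spin]
  have hpair : ∀ σ σ', (gaussianVec n).real (E σ ∩ E σ') ≤
      p ^ 2 * Real.exp (a ^ 2) * (1 + √n * innerBar σ σ' ^ 2)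
        + (if σ' = σ then p else 0) + (if σ' = -σ then p else 0) := by
    intro σ σ'
    -- The pairs `σ' = ±σ` are completely dependent; each contributes `p` itself.
    have hnn : 0 ≤ p ^ 2 * Real.exp (a ^ 2) * (1 + √n * innerBar σ σ' ^ 2) := by positivity
    have hle : (gaussianVec n).real (E σ ∩ E σ') ≤ p :=
      (measureReal_mono Set.inter_subset_left).trans (hEp σ).le
    have hi : ∀ (q : Prop) [Decidable q], 0 ≤ if q then p else 0 := fun q _ => by
      split_ifs <;> positivity
    by_cases h0 : σ' = σ
    · have := hi (σ' = -σ)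
      rw [if_pos h0]; linarith
    by_cases h1 : σ' = -σ
    · have := hi (σ' = σ)
      rw [if_pos h1]; linarith
    rw [if_neg h0, if_neg h1, add_zero, add_zero]
    have hd : 0 < hammingDist σ σ' := hammingDist_pos.2 (Ne.symm h0)
    have hd' := hammingDist_lt_of_ne_neg h1
    refine (prob_pair_le hd hd' (A := A) (by positivity)).trans ?_
    have hd1 : (1 : ℝ) ≤ hammingDist σ σ' := by exact_mod_cast hd
    have hd2 : (hammingDist σ σ' : ℝ) + 1 ≤ n := by exact_mod_cast hd'
    have hr := density_ratio_le hd1 hd2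
    rw [← innerBar_eq] at hr
    set D := √((n - hammingDist σ σ') * hammingDist σ σ' : ℝ)
    have hD : 0 < D := Real.sqrt_pos.2 (mul_pos (by linarith) (by linarith))
    have hp2 : (2 * a ^ 2 / Real.pi) ≤ p ^ 2 * Real.exp (a ^ 2) := by
      have h2 := pow_le_pow_left₀ (by positivity) hlow 2
      rw [mul_pow, div_pow, Real.sq_sqrt (by positivity), ← Real.exp_nat_mul,
        show ((2 : ℕ) : ℝ) * -(a ^ 2 / 2) = -a ^ 2 by push_cast; ring, Real.exp_neg] at h2
      rw [← div_eq_mul_inv, div_le_iff₀ (by positivity)] at h2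
      refine le_trans (le_of_eq ?_) h2
      field_simp
    calc A ^ 2 / (Real.pi * D) = (2 * a ^ 2 / Real.pi) * (n / (2 * D)) := by
          rw [hA, mul_pow, hsq]; field_simp
      _ ≤ _ := by gcongr
  have htot : ∑ σ, ∑ σ', (gaussianVec n).real (E σ ∩ E σ') ≤
      2 ^ n * (p ^ 2 * Real.exp (a ^ 2) * (2 ^ n * (1 + (√n)⁻¹)) + 2 * p) := by
    rw [← card_spin n, ← nsmul_eq_mul]
    refine Finset.sum_le_card_nsmul _ _ _ fun σ _ => ?_
    refine (Finset.sum_le_sum fun σ' _ => hpair σ σ').trans (le_of_eq ?_)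
    rw [Finset.sum_add_distrib, Finset.sum_add_distrib, ← Finset.mul_sum,
      Finset.sum_add_distrib, ← Finset.mul_sum, sum_innerBar_sq hn, card_spin]
    simp only [Finset.sum_const, nsmul_eq_mul, Finset.card_univ, card_spin, mul_one,
      Finset.sum_ite_eq', Finset.mem_univ, if_true]
    have : √(n : ℝ) * (2 ^ n / n) = 2 ^ n * (√n)⁻¹ := by
      nth_rewrite 2 [← hsq]; field_simp
    rw [this]; ring
  have hch := prob_none_le_second_moment (gaussianVec n) (E := E)
    (fun σ => measurableSet_signedSum_le σ A) (by rw [hsum]; positivity)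
  rw [hsum] at hch
  refine hch.trans (sub_le_sub_right ?_ _)
  calc _ ≤ 2 ^ n * (p ^ 2 * Real.exp (a ^ 2) * (2 ^ n * (1 + (√n)⁻¹)) + 2 * p)
        / (2 ^ n * p) ^ 2 := by gcongr
    _ = Real.exp (a ^ 2) * (1 + (√n)⁻¹) + 2 / (2 ^ n * p) := by field_simp
    _ ≤ Real.exp (a ^ 2) * (1 + (√n)⁻¹) +
        2 / (2 ^ n * (2 * a / √(2 * Real.pi) * Real.exp (-(a ^ 2 / 2)))) := by gcongr
    _ = _ := by rw [Real.exp_neg]; field_simp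

lemma energy_eq {n : ℕ} (x : Fin n → ℝ) (σ : Spin n) : energy x σ = |signedSum x σ| / √n := rfl

lemma energy_le_iff {n : ℕ} (hn : n ≠ 0) (x : Fin n → ℝ) (σ : Spin n) (a : ℝ) :
    energy x σ ≤ a ↔ |signedSum x σ| ≤ √n * a := by
  rw [energy_eq, div_le_iff₀ (by positivity), mul_comm]

/-- With high probability the ground state energy is at most `2 ^ (-nε)`, for every `ε < 1`. -/
lemma withHighProb_exists_energy_le {ε : ℝ} (h0 : 0 < ε) (h1 : ε < 1) :
    WithHighProb fun n x => ∃ σ : Spin n, energy x σ ≤ (2 : ℝ) ^ (-(n * ε)) := by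
  set a : ℕ → ℝ := fun n => (2 : ℝ) ^ (-(n * ε))
  have hpow : ∀ t : ℝ, 0 < t → Tendsto (fun n : ℕ => (2 : ℝ) ^ (-(n * t))) atTop (𝓝 0) := by
    intro t ht
    have h := tendsto_pow_atTop_nhds_zero_of_lt_one (r := (2 : ℝ) ^ (-t)) (by positivity)
      (Real.rpow_lt_one_of_one_lt_of_neg one_lt_two (by linarith))
    refine h.congr fun n => ?_
    rw [← Real.rpow_natCast, ← Real.rpow_mul two_pos.le]
    congr 1; ring
  have ha : Tendsto a atTop (𝓝 0) := hpow ε h0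
  have hsq : Tendsto (fun n : ℕ => (√(n : ℝ))⁻¹) atTop (𝓝 0) :=
    (Real.tendsto_sqrt_atTop.comp tendsto_natCast_atTop_atTop).inv_tendsto_atTop
  have hlim : Tendsto (fun n : ℕ => Real.exp (a n ^ 2) * (1 + (√n)⁻¹) +
      √(2 * Real.pi) * Real.exp (a n ^ 2 / 2) * (2 : ℝ) ^ (-(n * (1 - ε))) - 1) atTop (𝓝 0) := by
    have e1 : Tendsto (fun n => Real.exp (a n ^ 2)) atTop (𝓝 (Real.exp (0 ^ 2))) :=
      (Real.continuous_exp.tendsto _).comp (ha.pow 2)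
    have e2 : Tendsto (fun n => Real.exp (a n ^ 2 / 2)) atTop (𝓝 (Real.exp (0 ^ 2 / 2))) :=
      (Real.continuous_exp.tendsto _).comp ((ha.pow 2).div_const 2)
    have := ((e1.mul (hsq.const_add 1)).add ((e2.const_mul √(2 * Real.pi)).mul
      (hpow (1 - ε) (by linarith)))).sub_const 1
    simpa using this
  have hlim' := ENNReal.tendsto_ofReal hlim
  rw [ENNReal.ofReal_zero] at hlim'
  refine tendsto_of_tendsto_of_tendsto_of_le_of_le' tendsto_const_nhds hlim'
    (Eventually.of_forall fun _ => zero_le) ?_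
  filter_upwards [eventually_ne_atTop 0] with n hn
  have hb := prob_no_small_sum_le hn (a := a n) (by positivity)
  have hset : {x : Fin n → ℝ | ¬ ∃ σ : Spin n, energy x σ ≤ (2 : ℝ) ^ (-(n * ε))}
      = {x | ∀ σ : Spin n, ¬ |signedSum x σ| ≤ √n * a n} := by
    ext x; simp only [Set.mem_ofPred_eq, not_exists, energy_le_iff hn, a]
  rw [hset, ← ofReal_measureReal]
  refine ENNReal.ofReal_le_ofReal (hb.trans (le_of_eq ?_))
  have : (2 : ℝ) ^ (-(n * (1 - ε))) = (2 ^ n * a n)⁻¹ := by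
    rw [← Real.rpow_natCast, ← Real.rpow_add two_pos, ← Real.rpow_neg two_pos.le]
    congr 1; ring
  rw [this, div_eq_mul_inv]

/-! ### Existence of overlap gap parameters -/

/-- Exponential Markov bound for the number of configurations whose overlap with `σ` has absolute
value at least `ρ`. -/
lemma card_overlap_ge_le {n : ℕ} (hn : n ≠ 0) (σ : Spin n) (ρ : ℝ) {l : ℝ} (hl : 0 ≤ l) :
    (Nat.card {σ' : Spin n // ρ ≤ |innerBar σ σ'|} : ℝ) ≤
      2 * (Real.exp (l * (1 - ρ)) + Real.exp (-(l * (1 + ρ)))) ^ n := by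
  classical
  have hn0 : (0 : ℝ) < n := by positivity
  set S : Spin n → ℝ := fun σ' => ∑ i, ((σ i : ℤ) : ℝ) * ((σ' i : ℤ) : ℝ) with hS
  rw [Nat.card_eq_fintype_card, Fintype.card_subtype, Finset.card_eq_sum_ones, Nat.cast_sum,
    Finset.sum_filter]
  calc _ ≤ ∑ σ', (Real.exp (-(l * ρ * n)) * Real.exp (l * S σ')
          + Real.exp (-(l * ρ * n)) * Real.exp (-l * S σ')) := by
        refine Finset.sum_le_sum fun σ' _ => ?_
        split_ifs with h
        · rw [innerBar, abs_div, Nat.abs_cast, le_div_iff₀ hn0] at h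
          rw [← Real.exp_add, ← Real.exp_add, Nat.cast_one]
          rcases le_abs.1 h with h' | h'
          · refine le_add_of_le_of_nonneg (Real.one_le_exp ?_) (Real.exp_nonneg _)
            nlinarith [mul_le_mul_of_nonneg_left h' hl]
          · refine le_add_of_nonneg_of_le (Real.exp_nonneg _) (Real.one_le_exp ?_)
            nlinarith [mul_le_mul_of_nonneg_left h' hl]
        · positivity
    _ = 2 * (Real.exp (-(l * ρ)) * (Real.exp l + Real.exp (-l))) ^ n := by
        rw [Finset.sum_add_distrib, ← Finset.mul_sum, ← Finset.mul_sum, sum_exp_mul_overlap,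
          sum_exp_mul_overlap, neg_neg, mul_pow, ← Real.exp_nat_mul, mul_neg, mul_comm (n : ℝ)]
        ring
    _ = _ := by
        rw [mul_add, ← Real.exp_add, ← Real.exp_add]
        ring_nf

/-- Union bound over all pairs whose overlap is at least `ρ` in absolute value. -/
lemma prob_close_pair_le {n : ℕ} (hn : n ≠ 0) {ρ l a : ℝ} (hl : 0 ≤ l) (ha : 0 ≤ a) :
    (gaussianVec n).real {x | ∃ σ σ' : Spin n,
        |innerBar σ σ'| ∈ Set.Icc ρ (((n : ℝ) - 2) / n) ∧ energy x σ ≤ a ∧ energy x σ' ≤ a} ≤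
      2 ^ n * (2 * (Real.exp (l * (1 - ρ)) + Real.exp (-(l * (1 + ρ)))) ^ n) * (n * a ^ 2) := by
  classical
  have hn0 : (0 : ℝ) < n := by positivity
  set E : Spin n → Spin n → Set (Fin n → ℝ) := fun σ σ' =>
    {x | |innerBar σ σ'| ∈ Set.Icc ρ (((n : ℝ) - 2) / n) ∧ energy x σ ≤ a ∧ energy x σ' ≤ a}
  have hE : ∀ σ σ', (gaussianVec n).real (E σ σ') ≤
      if ρ ≤ |innerBar σ σ'| then n * a ^ 2 else 0 := by
    intro σ σ'
    by_cases h : |innerBar σ σ'| ∈ Set.Icc ρ (((n : ℝ) - 2) / n)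
    · rw [if_pos h.1]
      have hlt : |innerBar σ σ'| < 1 := lt_of_le_of_lt h.2 (by
        rw [div_lt_one hn0]; linarith)
      have h0 : 0 < hammingDist σ σ' := by
        rw [pos_iff_ne_zero]
        intro h0
        rw [innerBar_eq, h0] at hlt
        simp [hn] at hlt
      have h1 : hammingDist σ σ' < n := by
        refine hammingDist_lt_of_ne_neg fun h1 => ?_
        have : innerBar σ σ' = -1 := by
          rw [h1, innerBar]
          simp only [Pi.neg_apply, Units.val_neg, Int.cast_neg, mul_neg, ← sq, spin_sq]
          simp [hn]
        rw [this] at hlt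
        simp at hlt
      have hsub : E σ σ' = {x | |signedSum x σ| ≤ √n * a ∧ |signedSum x σ'| ≤ √n * a} := by
        ext x
        simp only [E, Set.mem_ofPred_eq, h, true_and, energy_le_iff hn]
      rw [hsub]
      refine (prob_pair_le h0 h1 (by positivity)).trans ?_
      rw [mul_pow, Real.sq_sqrt hn0.le]
      refine div_le_self (by positivity) ?_
      have h0' : (1 : ℝ) ≤ hammingDist σ σ' := by exact_mod_cast h0
      have h1' : (hammingDist σ σ' : ℝ) + 1 ≤ n := by exact_mod_cast h1
      have : (1 : ℝ) ≤ √((n - hammingDist σ σ') * hammingDist σ σ') :=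
        Real.one_le_sqrt.2 (by nlinarith)
      nlinarith [Real.pi_gt_three]
    · have : E σ σ' = ∅ := by
        ext x
        simp only [E, Set.mem_ofPred_eq, h, false_and, Set.mem_empty_iff_false]
      rw [this, measureReal_empty]
      split_ifs <;> positivity
  have hU : {x | ∃ σ σ' : Spin n,
        |innerBar σ σ'| ∈ Set.Icc ρ (((n : ℝ) - 2) / n) ∧ energy x σ ≤ a ∧ energy x σ' ≤ a}
      = ⋃ σ, ⋃ σ', E σ σ' := by
    ext x; simp only [E, Set.mem_ofPred_eq, Set.mem_iUnion]
  rw [hU]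
  calc _ ≤ ∑ σ, ∑ σ', (gaussianVec n).real (E σ σ') :=
        (measureReal_iUnion_fintype_le _).trans
          (Finset.sum_le_sum fun σ _ => measureReal_iUnion_fintype_le _)
    _ ≤ ∑ σ : Spin n, 2 * (Real.exp (l * (1 - ρ)) + Real.exp (-(l * (1 + ρ)))) ^ n
          * (n * a ^ 2) := by
        refine Finset.sum_le_sum fun σ _ => (Finset.sum_le_sum fun σ' _ => hE σ σ').trans ?_
        rw [← Finset.sum_filter, Finset.sum_const, nsmul_eq_mul, ← Fintype.card_subtype,
          ← Nat.card_eq_fintype_card]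
        gcongr
        exact card_overlap_ge_le hn σ ρ hl
    _ = _ := by
        rw [Finset.sum_const, nsmul_eq_mul, Finset.card_univ, card_spin]
        ring

/-- For `ε > 1/2` there are an overlap `ρ < 1` and a tilt `l` at which the exponential growth rate
of the expected number of close pairs is negative. -/
lemma exists_overlap_rate_lt_one {ε : ℝ} (hε : 1 / 2 < ε) :
    ∃ ρ ∈ Set.Ioo (0 : ℝ) 1, ∃ l : ℝ, 0 ≤ l ∧
      (2 : ℝ) ^ (1 - 2 * ε) * (Real.exp (l * (1 - ρ)) + Real.exp (-(l * (1 + ρ)))) < 1 := by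
  set κ := (2 : ℝ) ^ (1 - 2 * ε)
  have hκ0 : 0 < κ := by positivity
  have hκ1 : κ < 1 := Real.rpow_lt_one_of_one_lt_of_neg one_lt_two (by linarith)
  have hg : 0 < (κ⁻¹ - 1) / 2 := by
    have := (one_lt_inv₀ hκ0).2 hκ1
    linarith
  obtain ⟨l, hl0, hl⟩ : ∃ l : ℝ, 0 ≤ l ∧ Real.exp (-l) < (κ⁻¹ - 1) / 2 :=
    ((eventually_ge_atTop 0).and
      (Real.tendsto_exp_neg_atTop_nhds_zero.eventually_lt_const hg)).exists
  have hc : Tendsto (fun ρ : ℝ => Real.exp (l * (1 - ρ))) (𝓝[<] 1) (𝓝 1) := by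
    have : Continuous fun ρ : ℝ => Real.exp (l * (1 - ρ)) := by fun_prop
    simpa using (this.tendsto 1).mono_left nhdsWithin_le_nhds
  obtain ⟨ρ, hρ1, hρ⟩ := ((hc.eventually_lt_const (show 1 < 1 + (κ⁻¹ - 1) / 2 by linarith)).and
    (Ioo_mem_nhdsLT zero_lt_one)).exists
  refine ⟨ρ, hρ, l, hl0, ?_⟩
  have h3 : Real.exp (-(l * (1 + ρ))) ≤ Real.exp (-l) :=
    Real.exp_le_exp.2 (by nlinarith [hρ.1, mul_nonneg hl0 hρ.1.le])
  calc _ < κ * κ⁻¹ := by gcongr; linarith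
    _ = 1 := mul_inv_cancel₀ hκ0.ne'

lemma exists_isOGPParameter {ε : ℝ} (hε : 1 / 2 < ε) : ∃ ρ, IsOGPParameter ε ρ := by
  obtain ⟨ρ, hρ, l, hl, hb⟩ := exists_overlap_rate_lt_one hε
  refine ⟨ρ, hρ, fun K hK => ?_⟩
  set g := Real.exp (l * (1 - ρ)) + Real.exp (-(l * (1 + ρ)))
  set b := (2 : ℝ) ^ (1 - 2 * ε) * g
  have hb0 : 0 < b := by positivity
  have hs0 : 0 < √b := Real.sqrt_pos.2 hb0
  have hs1 : √b < 1 := by rw [Real.sqrt_lt' one_pos]; simpa using hb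
  refine ⟨-Real.log √b, neg_pos.2 (Real.log_neg hs0 hs1), ?_⟩
  have hlim : Tendsto (fun n : ℕ => 2 * K ^ 2 * (n * √b ^ n)) atTop (𝓝 0) := by
    simpa using (tendsto_self_mul_const_pow_of_lt_one hs0.le hs1).const_mul (2 * K ^ 2)
  filter_upwards [eventually_ne_atTop 0, hlim.eventually_le_const one_pos] with n hn hsmall
  rw [← ofReal_measureReal]
  refine ENNReal.ofReal_le_ofReal ((prob_close_pair_le hn hl (by positivity)).trans ?_)
  have e1 : Real.exp (-(-Real.log √b * n)) = √b ^ n := by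
    rw [neg_mul, neg_neg, mul_comm, Real.exp_nat_mul, Real.exp_log hs0]
  have e2 : (2 : ℝ) ^ n * ((2 : ℝ) ^ (-(n * ε))) ^ 2 = ((2 : ℝ) ^ (1 - 2 * ε)) ^ n := by
    rw [← Real.rpow_natCast _ n, ← Real.rpow_natCast _ 2, ← Real.rpow_natCast _ n,
      ← Real.rpow_mul two_pos.le, ← Real.rpow_mul two_pos.le, ← Real.rpow_add two_pos]
    congr 1; push_cast; ring
  rw [e1]
  calc _ = 2 * K ^ 2 * (n * ((2 : ℝ) ^ n * ((2 : ℝ) ^ (-(n * ε))) ^ 2 * g ^ n)) := by ring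
    _ = 2 * K ^ 2 * (n * (√b * √b) ^ n) := by
        rw [e2, ← mul_pow, Real.mul_self_sqrt hb0.le]
    _ = 2 * K ^ 2 * (n * √b ^ n) * √b ^ n := by ring
    _ ≤ 1 * √b ^ n := by gcongr
    _ = _ := one_mul _

/-! ### Escape of reversible nearest-neighbour chains -/

section MarkovChain

variable {n : ℕ} {ν : Spin n → ℝ} {Q : Spin n → Spin n → ℝ} {Ω : Type u} [MeasurableSpace Ω]
  {P : Measure Ω} {Y : ℕ → Ω → Spin n}

lemma measure_eq_sum_history (hY : IsMarkovChain ν Q P Y) (t : ℕ) {A : Set Ω}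
    (hA : MeasurableSet A) :
    P A = ∑ h : Fin t → Spin n, P (A ∩ {ω | ∀ i : Fin t, Y i ω = h i}) := by
  have hm : ∀ h : Fin t → Spin n, MeasurableSet (A ∩ {ω | ∀ i : Fin t, Y i ω = h i}) := fun h => by
    rw [Set.ofPred_forall]
    exact hA.inter (MeasurableSet.iInter fun i => hY.measurable _ _)
  have hd : Pairwise (Function.onFun Disjoint
      fun h : Fin t → Spin n => A ∩ {ω | ∀ i : Fin t, Y i ω = h i}) := by
    intro h h' hne
    refine Set.disjoint_left.2 fun ω h1 h2 => hne ?_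
    ext i : 1
    exact (h1.2 i).symm.trans (h2.2 i)
  refine Eq.trans ?_ ((measure_iUnion hd hm).trans (tsum_fintype _))
  congr 1
  ext ω
  simp only [Set.mem_iUnion, Set.mem_inter_iff, Set.mem_ofPred_eq, exists_and_left]
  exact ⟨fun h => ⟨h, fun i => Y i ω, fun _ => rfl⟩, fun h => h.1⟩

lemma IsMarkovChain.measure_zero (hY : IsMarkovChain ν Q P Y) (a : Spin n) :
    P {ω | Y 0 ω = a} = ENNReal.ofReal (ν a) := by
  simpa using hY.law 0 fun _ => a

/-- The Markov property for two consecutive times, obtained by summing the law of the path over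
the states visited before time `t`. -/
lemma IsMarkovChain.measure_step (hY : IsMarkovChain ν Q P Y) (hν : ∀ σ, 0 ≤ ν σ)
    (hQ : ∀ σ σ', 0 ≤ Q σ σ') (t : ℕ) (a b : Spin n) :
    P {ω | Y t ω = a ∧ Y (t + 1) ω = b} = P {ω | Y t ω = a} * ENNReal.ofReal (Q a b) := by
  have hm : MeasurableSet {ω | Y t ω = a ∧ Y (t + 1) ω = b} :=
    (hY.measurable _ _).inter (hY.measurable _ _)
  rw [measure_eq_sum_history hY t hm, measure_eq_sum_history hY t (hY.measurable t a),
    Finset.sum_mul]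
  refine Finset.sum_congr rfl fun h _ => ?_
  set s : ℕ → Spin n := fun i => if hi : i < t then h ⟨i, hi⟩ else if i = t then a else b with hs
  have s1 : ∀ i : Fin t, s i = h i := fun i => by simp [hs]
  have s2 : s t = a := by simp [hs]
  have s3 : s (t + 1) = b := by simp [hs]
  have e1 : {ω | Y t ω = a} ∩ {ω | ∀ i : Fin t, Y i ω = h i} = {ω | ∀ i, i ≤ t → Y i ω = s i} := by
    ext ω
    constructor
    · rintro ⟨h1, h2⟩ i hi
      rcases hi.lt_or_eq with hi | rfl
      · exact (h2 ⟨i, hi⟩).trans (s1 ⟨i, hi⟩).symm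
      · exact h1.trans s2.symm
    · exact fun h1 => ⟨(h1 t le_rfl).trans s2, fun i => (h1 i i.2.le).trans (s1 i)⟩
  have e2 : {ω | Y t ω = a ∧ Y (t + 1) ω = b} ∩ {ω | ∀ i : Fin t, Y i ω = h i}
      = {ω | ∀ i, i ≤ t + 1 → Y i ω = s i} := by
    ext ω
    constructor
    · rintro ⟨⟨h1, h1'⟩, h2⟩ i hi
      rcases hi.lt_or_eq with hi | rfl
      · rcases (Nat.lt_succ_iff.1 hi).lt_or_eq with hi | rfl
        · exact (h2 ⟨i, hi⟩).trans (s1 ⟨i, hi⟩).symm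
        · exact h1.trans s2.symm
      · exact h1'.trans s3.symm
    · exact fun h1 => ⟨⟨(h1 t (by omega)).trans s2, (h1 (t + 1) le_rfl).trans s3⟩,
        fun i => (h1 i (by omega)).trans (s1 i)⟩
  rw [e1, e2, hY.law, hY.law, Finset.prod_range_succ, s2, s3, ← mul_assoc,
    ENNReal.ofReal_mul (mul_nonneg (hν _) (Finset.prod_nonneg fun _ _ => hQ _ _))]

/-- A chain started below a multiple of its reversible measure stays below it. -/
lemma IsMarkovChain.measure_le (hY : IsMarkovChain ν Q P Y) (hν : ∀ σ, 0 ≤ ν σ) {μ : Spin n → ℝ}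
    (hQ : IsReversibleNearestNeighbour μ Q) (hνμ : ∀ σ, ν σ ≤ μ σ) (t : ℕ) (a : Spin n) :
    P {ω | Y t ω = a} ≤ ENNReal.ofReal (μ a) := by
  induction t generalizing a with
  | zero =>
    rw [hY.measure_zero]
    exact ENNReal.ofReal_le_ofReal (hνμ a)
  | succ t ih =>
    have hcov : {ω | Y (t + 1) ω = a} ⊆ ⋃ c, {ω | Y t ω = c ∧ Y (t + 1) ω = a} := fun ω hω =>
      Set.mem_iUnion.2 ⟨Y t ω, rfl, hω⟩
    have hμ : ∀ σ, 0 ≤ μ σ := fun σ => (hν σ).trans (hνμ σ)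
    calc _ ≤ ∑ c, P {ω | Y t ω = c ∧ Y (t + 1) ω = a} :=
          (measure_mono hcov).trans (measure_iUnion_fintype_le _ _)
      _ ≤ ∑ c, ENNReal.ofReal (μ c * Q c a) := by
          refine Finset.sum_le_sum fun c _ => ?_
          rw [hY.measure_step hν hQ.nonneg, ENNReal.ofReal_mul (hμ c)]
          gcongr
          exact ih c
      _ = ENNReal.ofReal (μ a) := by
          rw [← ENNReal.ofReal_sum_of_nonneg fun c _ => mul_nonneg (hμ c) (hQ.nonneg _ _)]
          simp only [hQ.reversible _ a]
          rw [← Finset.mul_sum, hQ.sum_eq_one, mul_one]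

/-- A nearest-neighbour chain leaves the ball of radius one around `σs` only from its boundary, so
the escape probability by time `T` is at most `T` times the stationary mass of the boundary. -/
lemma IsMarkovChain.measure_exitTime_lt_le (hY : IsMarkovChain ν Q P Y) (hν : ∀ σ, 0 ≤ ν σ)
    {μ : Spin n → ℝ} (hQ : IsReversibleNearestNeighbour μ Q) (hνμ : ∀ σ, ν σ ≤ μ σ) {σs : Spin n}
    (hsupp : ∀ σ, σ ∉ I₃ σs ∪ bdryS σs → ν σ = 0) {T : ℝ} (hT : 0 ≤ T) :
    P {ω | (exitTime (I₃ σs ∪ bdryS σs) Y ω : ℝ≥0∞) < ENNReal.ofReal T}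
      ≤ ENNReal.ofReal (T * ∑ σ, (bdryS σs).indicator μ σ) := by
  classical
  set A := I₃ σs ∪ bdryS σs with hA
  have hμ : ∀ σ, 0 ≤ μ σ := fun σ => (hν σ).trans (hνμ σ)
  have h0 : P {ω | Y 0 ω ∉ A} = 0 := by
    refine measure_mono_null (t := ⋃ σ : {σ // σ ∉ A}, {ω | Y 0 ω = σ})
      (fun ω hω => Set.mem_iUnion.2 ⟨⟨_, hω⟩, rfl⟩) (measure_iUnion_null fun σ => ?_)
    rw [hY.measure_zero, hsupp _ σ.2, ENNReal.ofReal_zero]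
  have h1 : ∀ t, P {ω | Y t ω = σs ∧ Y (t + 1) ω ∉ A} = 0 := fun t => by
    refine measure_mono_null (t := ⋃ σ : {σ // σ ∉ A}, {ω | Y t ω = σs ∧ Y (t + 1) ω = σ})
      (fun ω hω => Set.mem_iUnion.2 ⟨⟨_, hω.2⟩, hω.1, rfl⟩) (measure_iUnion_null fun σ => ?_)
    have hd : 1 < hammingDist σs σ := by
      have h2 : (σ : Spin n) ≠ σs := fun h => σ.2 (Or.inl h)
      have h3 : hammingDist (σ : Spin n) σs ≠ 1 := fun h => σ.2 (Or.inr h)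
      have := hammingDist_pos.2 h2
      rw [hammingDist_comm]
      omega
    rw [hY.measure_step hν hQ.nonneg, hQ.nearest _ _ hd, ENNReal.ofReal_zero, mul_zero]
  have h2 : ∀ t, P {ω | Y t ω ∈ bdryS σs} ≤ ENNReal.ofReal (∑ σ, (bdryS σs).indicator μ σ) :=
    fun t => by
    have hcov : {ω | Y t ω ∈ bdryS σs} ⊆ ⋃ σ ∈ Finset.univ.filter (· ∈ bdryS σs),
        {ω | Y t ω = σ} := fun ω hω => by
      simpa using hω
    refine (measure_mono hcov).trans ((measure_biUnion_finset_le _ _).trans ?_)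
    rw [ENNReal.ofReal_sum_of_nonneg fun σ _ => Set.indicator_nonneg (fun σ _ => hμ σ) σ,
      Finset.sum_filter]
    refine Finset.sum_le_sum fun σ _ => ?_
    split_ifs with h
    · rw [Set.indicator_of_mem h]
      exact hY.measure_le hν hQ hνμ t σ
    · exact zero_le
  have hcov : {ω | (exitTime A Y ω : ℝ≥0∞) < ENNReal.ofReal T} ⊆
      {ω | Y 0 ω ∉ A} ∪ ⋃ t ∈ Finset.range ⌊T⌋₊,
        ({ω | Y t ω = σs ∧ Y (t + 1) ω ∉ A} ∪ {ω | Y t ω ∈ bdryS σs}) := by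
    intro ω hω
    rw [Set.mem_ofPred_eq] at hω
    have hne : exitTime A Y ω ≠ ⊤ := fun h => by simp [h] at hω
    obtain ⟨t, htA, ht⟩ : ∃ t : ℕ, Y t ω ∉ A ∧ (t : ℕ∞) ≤ exitTime A Y ω := by
      have hlt : exitTime A Y ω < exitTime A Y ω + 1 := ENat.lt_add_one_iff hne |>.2 le_rfl
      nth_rewrite 1 [exitTime] at hlt
      simp only [iInf_lt_iff] at hlt
      obtain ⟨t, htA, ht⟩ := hlt
      exact ⟨t, htA, (ENat.lt_add_one_iff hne).1 ht⟩
    have htT : (t : ℝ) ≤ T := by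
      have h3 : ((t : ℕ∞) : ℝ≥0∞) < ENNReal.ofReal T :=
        lt_of_le_of_lt (ENat.toENNReal_le.2 ht) hω
      rw [ENat.toENNReal_coe, ← ENNReal.ofReal_natCast] at h3
      exact ((ENNReal.ofReal_lt_ofReal_iff_of_nonneg (by positivity)).1 h3).le
    -- At the first exit time the previous state is `σs` or lies on the boundary.
    have hex : ∃ t, Y t ω ∉ A := ⟨t, htA⟩
    have hfind := Nat.find_spec hex
    have hle : Nat.find hex ≤ t := Nat.find_min' hex htA
    rcases h : Nat.find hex with _ | k
    · left; rwa [h] at hfind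
    · right
      rw [h] at hfind hle
      have hk : Y k ω ∈ A := not_not.1 (Nat.find_min hex (by omega))
      refine Set.mem_iUnion₂.2 ⟨k, Finset.mem_range.2 (Nat.lt_of_succ_le
        (Nat.le_floor ((Nat.cast_le.2 hle).trans htT))), ?_⟩
      rcases hk with hk | hk
      · exact Or.inl ⟨hk, hfind⟩
      · exact Or.inr hk
  have hnn : 0 ≤ ∑ σ, (bdryS σs).indicator μ σ :=
    Finset.sum_nonneg fun σ _ => Set.indicator_nonneg (fun σ _ => hμ σ) σ
  calc _ ≤ P {ω | Y 0 ω ∉ A} + ∑ t ∈ Finset.range ⌊T⌋₊,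
          P ({ω | Y t ω = σs ∧ Y (t + 1) ω ∉ A} ∪ {ω | Y t ω ∈ bdryS σs}) :=
        (measure_mono hcov).trans ((measure_union_le _ _).trans
          (add_le_add le_rfl (measure_biUnion_finset_le _ _)))
    _ ≤ ∑ t ∈ Finset.range ⌊T⌋₊, ENNReal.ofReal (∑ σ, (bdryS σs).indicator μ σ) := by
        rw [h0, zero_add]
        refine Finset.sum_le_sum fun t _ => (measure_union_le _ _).trans ?_
        rw [h1, zero_add]
        exact h2 t
    _ ≤ _ := by
        rw [Finset.sum_const, Finset.card_range, nsmul_eq_mul, ← ENNReal.ofReal_natCast,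
          ← ENNReal.ofReal_mul (by positivity)]
        exact ENNReal.ofReal_le_ofReal (mul_le_mul_of_nonneg_right (Nat.floor_le hT) hnn)

end MarkovChain

/-! ### The Gibbs measure under an energy gap -/

section Gibbs

variable {n : ℕ} {b : ℝ} {x : Fin n → ℝ}

lemma partitionFn_pos : 0 < partitionFn b x :=
  Finset.sum_pos (fun _ _ => Real.exp_pos _) Finset.univ_nonempty

lemma gibbs_pos (σ : Spin n) : 0 < gibbs b x σ := div_pos (Real.exp_pos _) partitionFn_pos

lemma gibbs_neg (σ : Spin n) : gibbs b x (-σ) = gibbs b x σ := by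
  have : signedSum x (-σ) = -signedSum x σ := by simp [signedSum]
  rw [gibbs, gibbs, energy_eq, energy_eq, this, abs_neg]

lemma sum_gibbs : ∑ σ, gibbs b x σ = 1 := by
  simp only [gibbs, ← Finset.sum_div]
  exact div_self partitionFn_pos.ne'

lemma gibbsMass_mono {A B : Set (Spin n)} (h : A ⊆ B) : gibbsMass b x A ≤ gibbsMass b x B :=
  Finset.sum_le_sum fun σ _ =>
    Set.indicator_le_indicator_of_subset h (fun σ => (gibbs_pos σ).le) σ

lemma gibbsMass_union_le (A B : Set (Spin n)) :
    gibbsMass b x (A ∪ B) ≤ gibbsMass b x A + gibbsMass b x B := by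
  rw [gibbsMass, gibbsMass, gibbsMass, ← Finset.sum_add_distrib]
  refine Finset.sum_le_sum fun σ _ => ?_
  rw [← Set.indicator_union_add_inter_apply]
  exact le_add_of_nonneg_right (Set.indicator_nonneg (fun σ _ => (gibbs_pos σ).le) σ)

lemma gibbsMass_univ : gibbsMass b x Set.univ = 1 := by
  simp [gibbsMass, sum_gibbs]

lemma gibbsMass_singleton (σ : Spin n) : gibbsMass b x {σ} = gibbs b x σ := by
  classical
  simp [gibbsMass, Set.indicator_apply]

lemma gibbs_le_half (hn : n ≠ 0) (σ : Spin n) : gibbs b x σ ≤ 1 / 2 := by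
  have hne : σ ≠ -σ := fun h => by
    have h1 := congrFun h ⟨0, Nat.pos_of_ne_zero hn⟩
    rcases Int.units_eq_one_or (σ ⟨0, Nat.pos_of_ne_zero hn⟩) with h2 | h2 <;>
      simp [h2] at h1
  have h := Finset.sum_le_univ_sum_of_nonneg (s := {σ, -σ})
    fun τ => (gibbs_pos (b := b) (x := x) τ).le
  rw [Finset.sum_pair hne, gibbs_neg, sum_gibbs] at h
  linarith

/-- The configurations close to `σs` or to `-σs`, but different from both: those of overlap at
least `ρ` in absolute value. -/
def closeSet (ρ : ℝ) (σs : Spin n) : Set (Spin n) :=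
  {σ | σ ≠ σs ∧ σ ≠ -σs ∧ ρ ≤ |innerBar σ σs|}

/-- An energy gap of `(K - 1) η` above `σs` on `closeSet ρ σs` beats the entropy `n log 2`. -/
lemma gibbsMass_closeSet_le (hb : 0 ≤ b) {ρ K η : ℝ} {σs : Spin n} (hs : energy x σs ≤ η)
    (hgap : ∀ σ ∈ closeSet ρ σs, K * η ≤ energy x σ)
    (hK : n + 3 * (b * η) ≤ (K - 1) * (b * η)) :
    gibbsMass b x (closeSet ρ σs) ≤ Real.exp (-(3 * (b * η))) * gibbs b x σs := by
  have hpt : ∀ σ, (closeSet ρ σs).indicator (gibbs b x) σ ≤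
      Real.exp (-(n + 3 * (b * η))) * gibbs b x σs := by
    intro σ
    refine Set.indicator_apply_le' (fun hσ => ?_) fun _ =>
      mul_nonneg (Real.exp_nonneg _) (gibbs_pos _).le
    rw [gibbs, gibbs, ← mul_div_assoc, ← Real.exp_add]
    have := partitionFn_pos (b := b) (x := x)
    gcongr
    nlinarith [mul_le_mul_of_nonneg_left (hgap σ hσ) hb, mul_le_mul_of_nonneg_left hs hb]
  have h2 : (2 : ℝ) ^ n ≤ Real.exp n := by
    rw [← Real.exp_one_pow]
    exact pow_le_pow_left₀ two_pos.le (by linarith [Real.exp_one_gt_d9]) n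
  calc _ ≤ (2 : ℝ) ^ n * (Real.exp (-(n + 3 * (b * η))) * gibbs b x σs) := by
        rw [← card_spin n, ← nsmul_eq_mul]
        exact Finset.sum_le_card_nsmul _ _ _ fun σ _ => hpt σ
    _ ≤ Real.exp n * (Real.exp (-(n + 3 * (b * η))) * gibbs b x σs) := by
        have := gibbs_pos (b := b) (x := x) σs
        gcongr
    _ = _ := by
        rw [← mul_assoc, ← Real.exp_add]
        ring_nf

/-- Outside `I₁ ∪ {-σs}` there are only `σs`, of mass at most `1/2` by symmetry, and the close
configurations. -/
lemma half_sub_le_gibbsMass (hn : n ≠ 0) {ρ r : ℝ} {σs : Spin n}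
    (h : gibbsMass b x (closeSet ρ σs) ≤ r * gibbs b x σs) (hr : 0 ≤ r) :
    1 / 2 * (1 + -r) ≤ gibbsMass b x (I₁ ρ σs ∪ I₃bar σs) := by
  have hcov : Set.univ ⊆ (I₁ ρ σs ∪ I₃bar σs) ∪ ({σs} ∪ closeSet ρ σs) := by
    intro σ _
    by_cases h1 : σ = σs
    · exact Or.inr (Or.inl h1)
    by_cases h2 : σ = -σs
    · exact Or.inl (Or.inr h2)
    by_cases h3 : ρ ≤ |innerBar σ σs|
    · exact Or.inr (Or.inr ⟨h1, h2, h3⟩)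
    · exact Or.inl (Or.inl (abs_le.1 (not_le.1 h3).le))
  have h1 := gibbsMass_mono (b := b) (x := x) hcov
  have h2 := gibbsMass_union_le (b := b) (x := x) (I₁ ρ σs ∪ I₃bar σs) ({σs} ∪ closeSet ρ σs)
  have h3 := gibbsMass_union_le (b := b) (x := x) {σs} (closeSet ρ σs)
  rw [gibbsMass_univ] at h1
  rw [gibbsMass_singleton] at h3
  have h4 := gibbs_le_half (b := b) (x := x) hn σs
  nlinarith [mul_le_mul_of_nonneg_left h4 hr]

lemma bdryS_subset_closeSet (hn : 2 ≤ n) {ρ : ℝ} (hρ : ρ ≤ ((n : ℝ) - 2) / n) (σs : Spin n) :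
    bdryS σs ⊆ closeSet ρ σs := by
  intro σ (hσ : hammingDist σ σs = 1)
  have hn' : (2 : ℝ) ≤ n := by exact_mod_cast hn
  have hi : innerBar σ σs = ((n : ℝ) - 2) / n := by rw [innerBar_eq, hσ]; norm_num
  refine ⟨fun h => ?_, fun h => ?_, ?_⟩
  · rw [h, hammingDist_self] at hσ
    omega
  · have h1 : hammingDist σ σs = n := by
      rw [h]
      simp [hammingDist]
    omega
  · rw [hi]
    exact hρ.trans (le_abs_self _)

end Gibbs

/-! ### Slow escape and the gap with high probability -/

/-- The initial law is at most `gibbs b x / gibbsMass b x A`, where `A` is the ball of radius one,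
and that multiple of the Gibbs measure is again reversible. -/
lemma slowEscape_of_gibbsMass_bdryS_le {n : ℕ} {b r : ℝ} {x : Fin n → ℝ}
    (h : ∀ σs : Spin n, IsGroundState x σs →
      gibbsMass b x (bdryS σs) ≤ Real.exp (-(2 * r)) * gibbs b x σs) :
    SlowEscape.{u} b x r := by
  intro σs hσs Q hQ Ω _ P _ Y hY
  set A := I₃ σs ∪ bdryS σs
  have hM : gibbs b x σs ≤ gibbsMass b x A := by
    rw [← gibbsMass_singleton]
    exact gibbsMass_mono Set.subset_union_left
  have hM0 : 0 < gibbsMass b x A := (gibbs_pos σs).trans_le hM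
  set μ : Spin n → ℝ := fun σ => gibbs b x σ / gibbsMass b x A with hμ
  have hQ' : IsReversibleNearestNeighbour μ Q :=
    { nonneg := hQ.nonneg
      sum_eq_one := hQ.sum_eq_one
      nearest := hQ.nearest
      reversible := fun σ σ' => by
        simp only [hμ]
        rw [div_mul_eq_mul_div, div_mul_eq_mul_div, hQ.reversible] }
  have hν : ∀ σ, 0 ≤ gibbsCond b x A σ := fun σ =>
    div_nonneg (Set.indicator_nonneg (fun σ _ => (gibbs_pos σ).le) σ) hM0.le
  have hνμ : ∀ σ, gibbsCond b x A σ ≤ μ σ := fun σ =>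
    div_le_div_of_nonneg_right (Set.indicator_le_self' (fun σ _ => (gibbs_pos σ).le) σ) hM0.le
  refine (hY.measure_exitTime_lt_le hν hQ' hνμ (fun σ hσ => ?_) (Real.exp_nonneg r)).trans
    (ENNReal.ofReal_le_ofReal ?_)
  · rw [gibbsCond, Set.indicator_of_notMem hσ, zero_div]
  have hsum : ∑ σ, (bdryS σs).indicator μ σ = gibbsMass b x (bdryS σs) / gibbsMass b x A := by
    rw [gibbsMass, Finset.sum_div]
    refine Finset.sum_congr rfl fun σ _ => ?_
    by_cases hσ : σ ∈ bdryS σs <;> simp [hσ, hμ]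
  have hle : gibbsMass b x (bdryS σs) / gibbsMass b x A ≤ Real.exp (-(2 * r)) := by
    rw [div_le_iff₀ hM0]
    exact (h σs hσs).trans (by gcongr)
  calc _ ≤ Real.exp r * Real.exp (-(2 * r)) := by rw [hsum]; gcongr
    _ = _ := by rw [← Real.exp_add]; ring_nf

lemma SlowEscape.mono {n : ℕ} {b r r' : ℝ} {x : Fin n → ℝ} (h : SlowEscape.{u} b x r)
    (hr : r' ≤ r) : SlowEscape.{u} b x r' := by
  intro σs hσs Q hQ Ω _ P _ Y hY
  refine (measure_mono fun ω hω => ?_).trans ((h σs hσs Q hQ Ω P Y hY).trans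
    (ENNReal.ofReal_le_ofReal (Real.exp_le_exp.2 (neg_le_neg hr))))
  exact lt_of_lt_of_le hω (ENNReal.ofReal_le_ofReal (Real.exp_le_exp.2 hr))

lemma WithHighProb.mono {E F : ∀ n : ℕ, (Fin n → ℝ) → Prop} (hE : WithHighProb E)
    (h : ∀ᶠ n in atTop, ∀ x, E n x → F n x) : WithHighProb F := by
  refine tendsto_of_tendsto_of_tendsto_of_le_of_le' tendsto_const_nhds hE
    (Eventually.of_forall fun _ => zero_le) ?_
  filter_upwards [h] with n hn
  exact measure_mono fun x hx hEx => hx (hn x hEx)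

lemma WithHighProb.and {E F : ∀ n : ℕ, (Fin n → ℝ) → Prop} (hE : WithHighProb E)
    (hF : WithHighProb F) : WithHighProb fun n x => E n x ∧ F n x := by
  have h : Tendsto (fun n => gaussianVec n {x | ¬ E n x} + gaussianVec n {x | ¬ F n x}) atTop
      (𝓝 0) := by simpa using Tendsto.add hE hF
  refine tendsto_of_tendsto_of_tendsto_of_le_of_le tendsto_const_nhds h
    (fun _ => zero_le) fun n => (measure_mono fun x hx => ?_).trans (measure_union_le _ _)
  exact not_and_or.1 hx

/-- With high probability the ground states have energy at most `2 ^ (-nε)`, and every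
configuration close to a ground state has energy at least `K` times this level. -/
lemma withHighProb_gap {ε ρ K : ℝ} (hε0 : 0 < ε) (hε1 : ε < 1) (hρ : IsOGPParameter ε ρ)
    (hK : 1 ≤ K) :
    WithHighProb fun n x => ∀ σs : Spin n, IsGroundState x σs →
      energy x σs ≤ (2 : ℝ) ^ (-(n * ε)) ∧
      ∀ σ ∈ closeSet ρ σs, K * (2 : ℝ) ^ (-(n * ε)) ≤ energy x σ := by
  obtain ⟨c, hc, hev⟩ := hρ.2 K (by linarith)
  have hlim : Tendsto (fun n : ℕ => ENNReal.ofReal (Real.exp (-(c * n)))) atTop (𝓝 0) := by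
    rw [← ENNReal.ofReal_zero]
    refine ENNReal.tendsto_ofReal (Real.tendsto_exp_neg_atTop_nhds_zero.comp ?_)
    exact tendsto_natCast_atTop_atTop.const_mul_atTop hc
  have hogp : WithHighProb fun n x => ¬ ∃ σ σ' : Spin n,
      |innerBar σ σ'| ∈ Set.Icc ρ (((n : ℝ) - 2) / n) ∧
      energy x σ ≤ K * (2 : ℝ) ^ (-(n * ε)) ∧ energy x σ' ≤ K * (2 : ℝ) ^ (-(n * ε)) := by
    refine tendsto_of_tendsto_of_tendsto_of_le_of_le' tendsto_const_nhds hlim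
      (Eventually.of_forall fun _ => zero_le) ?_
    filter_upwards [hev] with n hn
    simpa only [not_not] using hn
  refine ((withHighProb_exists_energy_le hε0 hε1).and hogp).mono
    (Eventually.of_forall fun n x => ?_)
  rintro ⟨⟨σ₀, hσ₀⟩, hno⟩ σs hσs
  have hs : energy x σs ≤ (2 : ℝ) ^ (-(n * ε)) := (hσs σ₀).trans hσ₀
  refine ⟨hs, fun σ hσ => ?_⟩
  by_contra! hlt
  refine hno ⟨σ, σs, ⟨hσ.2.2, ?_⟩, hlt.le, hs.trans (le_mul_of_one_le_left (by positivity) hK)⟩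
  rw [innerBar_comm]
  exact abs_innerBar_le hσ.1 hσ.2.1

end NPP

theorem theorem3p4 (ε : ℝ) (hε : ε ∈ Set.Ioo (1 / 2 : ℝ) 1) :
    (∃ ρ : ℝ, NPP.IsOGPParameter ε ρ) ∧
    ∀ ρ : ℝ, NPP.IsOGPParameter ε ρ →
    ∀ β : ℕ → ℝ, (∀ n, 0 < β n) →
      (fun n : ℕ => (n : ℝ) * (2 : ℝ) ^ (n * ε)) =O[atTop] β →
      -- (a)
      (∃ δ : ℕ → ℝ, Tendsto δ atTop (𝓝 0) ∧
        NPP.WithHighProb fun n x => ∀ σs : NPP.Spin n, NPP.IsGroundState x σs →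
          1 / 2 * (1 + δ n) ≤ NPP.gibbsMass (β n) x (NPP.I₁ ρ σs ∪ NPP.I₃bar σs)) ∧
      -- (b)
      (∃ c : ℝ, 0 < c ∧
        NPP.WithHighProb fun n x =>
          NPP.SlowEscape.{u} (β n) x (c * (β n * (2 : ℝ) ^ (-(n * ε))))) ∧
      ((fun n : ℕ => (n : ℝ) * (2 : ℝ) ^ (n * ε)) =o[atTop] β →
        ∃ c : ℝ, 0 < c ∧
          NPP.WithHighProb fun n x => NPP.SlowEscape.{u} (β n) x (c * n)) := by
  refine ⟨NPP.exists_isOGPParameter hε.1, fun ρ hρ β hβ hO => ?_⟩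
  have hε0 : 0 < ε := by linarith [hε.1]
  set θ : ℕ → ℝ := fun n => β n * (2 : ℝ) ^ (-(n * ε)) with hθ
  have hθ0 : ∀ n, 0 < θ n := fun n => mul_pos (hβ n) (by positivity)
  -- A bound `n 2 ^ (nε) ≤ C β n` is a bound `n ≤ C θ n`.
  have hscale : ∀ (n : ℕ) (C : ℝ), ‖(n : ℝ) * (2 : ℝ) ^ (n * ε)‖ ≤ C * ‖β n‖ → n ≤ C * θ n := by
    intro n C h
    rw [Real.norm_of_nonneg (by positivity), Real.norm_of_nonneg (hβ n).le] at h
    rw [hθ]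
    simp only
    rw [Real.rpow_neg two_pos.le, ← mul_assoc, ← div_eq_mul_inv, le_div_iff₀ (by positivity)]
    exact h
  obtain ⟨C, hC0, hC⟩ := hO.exists_pos
  have hCθ : ∀ᶠ n : ℕ in atTop, (n : ℝ) ≤ C * θ n := hC.bound.mono fun n h => hscale n C h
  have hθlim : Tendsto θ atTop atTop := by
    refine tendsto_atTop_mono' _ (f₁ := fun n : ℕ => (n : ℝ) / C) ?_
      (tendsto_natCast_atTop_atTop.atTop_div_const hC0)
    filter_upwards [hCθ] with n hn
    rw [div_le_iff₀ hC0]; linarith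
  -- `K = C + 4` leaves room for the entropy `n ≤ C θ n` and a further factor `exp (-3 θ n)`.
  have hclose : NPP.WithHighProb fun n x => ∀ σs : NPP.Spin n, NPP.IsGroundState x σs →
      NPP.gibbsMass (β n) x (NPP.closeSet ρ σs) ≤
        Real.exp (-(3 * θ n)) * NPP.gibbs (β n) x σs := by
    refine (NPP.withHighProb_gap (K := C + 4) hε0 hε.2 hρ (by linarith)).mono ?_
    filter_upwards [hCθ] with n hn x hx σs hσs
    exact NPP.gibbsMass_closeSet_le (hβ n).le (hx σs hσs).1 (hx σs hσs).2
      (by simp only [hθ] at hn; linarith)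
  have hslow : NPP.WithHighProb fun n x => NPP.SlowEscape.{u} (β n) x (θ n) := by
    have hρn : ∀ᶠ n : ℕ in atTop, ρ ≤ ((n : ℝ) - 2) / n := by
      filter_upwards [tendsto_natCast_atTop_atTop.eventually_ge_atTop (2 / (1 - ρ)),
        eventually_gt_atTop 0] with n hn hn0
      have h1 : 0 < 1 - ρ := by linarith [hρ.1.2]
      rw [div_le_iff₀ h1] at hn
      rw [le_div_iff₀ (by positivity)]
      linarith
    refine hclose.mono ?_
    filter_upwards [hρn, eventually_ge_atTop 2] with n hn hn2 x hx
    refine NPP.slowEscape_of_gibbsMass_bdryS_le fun σs hσs => ?_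
    refine (NPP.gibbsMass_mono (NPP.bdryS_subset_closeSet hn2 hn σs)).trans
      ((hx σs hσs).trans ?_)
    have := NPP.gibbs_pos (b := β n) (x := x) σs
    refine mul_le_mul_of_nonneg_right (Real.exp_le_exp.2 ?_) this.le
    linarith [hθ0 n]
  refine ⟨⟨fun n => -Real.exp (-(3 * θ n)), ?_, ?_⟩, ⟨1, one_pos, ?_⟩, fun ho => ⟨1, one_pos, ?_⟩⟩
  · simpa using (Real.tendsto_exp_neg_atTop_nhds_zero.comp
      (hθlim.const_mul_atTop three_pos)).neg
  · refine hclose.mono ?_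
    filter_upwards [eventually_ne_atTop 0] with n hn x hx σs hσs
    exact NPP.half_sub_le_gibbsMass hn (hx σs hσs) (Real.exp_nonneg _)
  · simpa only [one_mul] using hslow
  · refine hslow.mono ?_
    filter_upwards [ho.bound one_pos] with n hn x hx
    exact hx.mono (by linarith [hscale n 1 hn])
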